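/- Let $\Sigma$ be a finite alphabet. A straight line program (SLP) of size $n\ge 1$ over $\Sigma$ is a sequence of assignments $X_i\to \mathit{expr}_i$ ($1\le i\le n$), where each $\mathit{expr}_i$ is either a letter of $\Sigma$ or a product $X_\ell X_r$ with $\ell,r<i$; it represents the string $S$ derived from $X_n$. The LZ78 factorization of $S$ is the factorization $S=f_1\cdots f_m$ such that for every $i=1,\dots,m$ the factor $f_i$ is the longest prefix of $f_i\cdots f_m$ that belongs to $F_i$, where $F_1=\Sigma$ and $F_{i+1}=F_i\cup\{f_i\,f_{i+1}[1]\}$, with $f_{i+1}[1]$ the first letter of $f_{i+1}$. Its size is $m$, and it is output as the sequence of the IDs of the $f_i$ in $F_i$: an ID names either a letter or an entry $f_k f_{k+1}[1]$ by its number $k<i$. There is an algorithm which, given an SLP of size $n$ that represents a string $S$, computes the LZ78 factorization of $S$ in $O(n^3m^2)$ time, where $m$ is the size of this factorization. The algorithm runs on a word RAM on which operations on words take constant time and whose word size $w$ is at least logarithmic in $|S|$, so that $|S|$, the size $n$ and the (numbered) letters of $\Sigma$ fit in a word: $|S|<2^w$, $n<2^w$, $|\Sigma|\le 2^w$. The algorithm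 and the constant in the $O$-bound do not depend on the SLP, on $\Sigma$ or on $w$. -/

import Mathlib

/-! ### Straight line programs -/

/-- The right-hand side of the `i`-th assignment: a letter, or a product of two
variables with indices smaller than `i`. -/
inductive SLP.Expr (α : Type) (i : ℕ) : Type
  | letter (a : α) : SLP.Expr α i
  | pair (l r : Fin i) : SLP.Expr α i

/-- A straight line program over the alphabet `α`: a nonempty sequence of assignments
`X_i → expr_i`, indexed from `0`. Its size is the number of assignments. -/
structure SLP (α : Type) : Type where
  size : ℕ
  size_pos : 0 < size
  rule : (i : Fin size) → SLP.Expr α i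

namespace SLP

variable {α : Type}

/-- The string derived from the variable `X_i`. -/
def val (G : SLP α) (i : ℕ) (hi : i < G.size) : List α :=
  match G.rule ⟨i, hi⟩ with
  | .letter a => [a]
  | .pair l r => G.val l (l.isLt.trans hi) ++ G.val r (r.isLt.trans hi)
termination_by i
decreasing_by
  · exact l.isLt
  · exact r.isLt

/-- The string represented by the program: the value of its last variable. -/
def str (G : SLP α) : List α :=
  G.val (G.size - 1) (Nat.sub_lt G.size_pos Nat.one_pos)

end SLP

/-! ### The LZ78 factorization

Factors are indexed from `0`: the list `fs` holds `f_1, …, f_m` at the places `0, …, m - 1`. -/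

namespace LZ78

variable {α : Type}

/-- The dictionary entry `f_k f_{k+1}[1]`: a factor followed by the first letter of the
next factor. -/
def entry (fs : List (List α)) (k : ℕ) : List α :=
  fs.getD k [] ++ (fs.getD (k + 1) []).take 1

/-- The dictionaries: the first one is the alphabet, and each following one has one entry
more. -/
def dict (fs : List (List α)) : ℕ → Set (List α)
  | 0 => {x | ∃ a : α, x = [a]}
  | i + 1 => dict fs i ∪ {entry fs i}

/-- `fs` is the LZ78 factorization of `S`: it is a factorization of `S`, and every factor is
the longest prefix of the remaining suffix that lies in the current dictionary. -/
def IsFactorization (S : List α) (fs : List (List α)) : Prop :=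
  fs.flatten = S ∧
    ∀ (i : ℕ) (hi : i < fs.length),
      fs[i] ∈ dict fs i ∧
        ∀ g ∈ dict fs i, g <+: (fs.drop i).flatten → g.length ≤ fs[i].length

/-- IDs of dictionary elements: a letter, or the number `k` of an entry. -/
inductive Id (α : Type) : Type
  | letter (a : α) : Id α
  | entry (k : ℕ) : Id α

/-- `x` is the ID of the string `f` in the `i`-th dictionary, which consists of the letters
and the entries with numbers `k < i`. -/
def Id.Denotes (fs : List (List α)) (i : ℕ) (f : List α) : Id α → Prop
  | .letter a => f = [a]
  | .entry k => k < i ∧ f = LZ78.entry fs k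

/-- `ids` is the sequence of the IDs of the factors in their dictionaries. -/
def IsEncoding (fs : List (List α)) (ids : List (Id α)) : Prop :=
  List.length ids = List.length fs ∧
    ∀ (i : ℕ) (hi : i < fs.length) (hi' : i < ids.length), ids[i].Denotes fs i fs[i]

end LZ78

/-! ### A word RAM

Programs are while programs over registers and arrays, both named by natural numbers in the
program text, so that a program uses finitely many of them. All values are words, that is,
natural numbers below `W = 2 ^ w` for the word size `w`, and an array is indexed by a word. -/

namespace RAM

/-- Operations on words that take constant time. -/
inductive Op : Type
  | add | sub | mul | div | mod | lt | eq

/-- Results are reduced modulo `W`; subtraction is truncated at `0`, division by `0` yields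
`0`, and comparisons yield `1` or `0`. -/
def Op.eval (W : ℕ) : Op → ℕ → ℕ → ℕ
  | .add, a, b => (a + b) % W
  | .sub, a, b => (a - b) % W
  | .mul, a, b => (a * b) % W
  | .div, a, b => (a / b) % W
  | .mod, a, b => (a % b) % W
  | .lt, a, b => (if a < b then 1 else 0) % W
  | .eq, a, b => (if a = b then 1 else 0) % W

/-- Contents of the registers and of the arrays. -/
@[ext]
structure State : Type where
  reg : ℕ → ℕ
  arr : ℕ → ℕ → ℕ

def State.setReg (s : State) (x v : ℕ) : State :=
  { s with reg := Function.update s.reg x v }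

def State.setArr (s : State) (b j v : ℕ) : State :=
  { s with arr := Function.update s.arr b (Function.update (s.arr b) j v) }

/-- Expressions: constants, registers, array cells, operations. -/
inductive Expr : Type
  | const (c : ℕ) : Expr
  | reg (x : ℕ) : Expr
  | read (b : ℕ) (e : Expr) : Expr
  | op (o : Op) (e₁ e₂ : Expr) : Expr

def Expr.eval (W : ℕ) (s : State) : Expr → ℕ
  | .const c => c % W
  | .reg x => s.reg x
  | .read b e => s.arr b (e.eval W s)
  | .op o e₁ e₂ => o.eval W (e₁.eval W s) (e₂.eval W s)

/-- The time to evaluate an expression: one step for each of its nodes. -/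
def Expr.cost : Expr → ℕ
  | .const _ => 1
  | .reg _ => 1
  | .read _ e => e.cost + 1
  | .op _ e₁ e₂ => e₁.cost + e₂.cost + 1

/-- Programs. `write b e₁ e₂` stores the value of `e₂` in the cell `e₁` of the array `b`. -/
inductive Cmd : Type
  | skip : Cmd
  | assign (x : ℕ) (e : Expr) : Cmd
  | write (b : ℕ) (e₁ e₂ : Expr) : Cmd
  | seq (c₁ c₂ : Cmd) : Cmd
  | ite (e : Expr) (c₁ c₂ : Cmd) : Cmd
  | while (e : Expr) (c : Cmd) : Cmd

/-- `Exec W c s s' t`: started in the state `s`, the program `c` halts in the state `s'` after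
exactly `t` steps. A condition holds if its value is not `0`. -/
inductive Exec (W : ℕ) : Cmd → State → State → ℕ → Prop
  | skip (s : State) : Exec W .skip s s 1
  | assign (x : ℕ) (e : Expr) (s : State) :
      Exec W (.assign x e) s (s.setReg x (e.eval W s)) (e.cost + 1)
  | write (b : ℕ) (e₁ e₂ : Expr) (s : State) :
      Exec W (.write b e₁ e₂) s (s.setArr b (e₁.eval W s) (e₂.eval W s))
        (e₁.cost + e₂.cost + 1)
  | seq {c₁ c₂ : Cmd} {s s' s'' : State} {t₁ t₂ : ℕ} :
      Exec W c₁ s s' t₁ → Exec W c₂ s' s'' t₂ → Exec W (.seq c₁ c₂) s s'' (t₁ + t₂)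
  | ite_true {e : Expr} {c₁ c₂ : Cmd} {s s' : State} {t : ℕ} :
      e.eval W s ≠ 0 → Exec W c₁ s s' t → Exec W (.ite e c₁ c₂) s s' (e.cost + 1 + t)
  | ite_false {e : Expr} {c₁ c₂ : Cmd} {s s' : State} {t : ℕ} :
      e.eval W s = 0 → Exec W c₂ s s' t → Exec W (.ite e c₁ c₂) s s' (e.cost + 1 + t)
  | while_true {e : Expr} {c : Cmd} {s s' s'' : State} {t₁ t₂ : ℕ} :
      e.eval W s ≠ 0 → Exec W c s s' t₁ → Exec W (.while e c) s' s'' t₂ →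
        Exec W (.while e c) s s'' (e.cost + 1 + t₁ + t₂)
  | while_false {e : Expr} {c : Cmd} {s : State} :
      e.eval W s = 0 → Exec W (.while e c) s s (e.cost + 1)

end RAM

/-! ### Input and output format -/

/-- The three words that describe the right-hand side of an assignment:
`0, a, 0` for a letter `a`, and `1, l, r` for a product `X_l X_r`. -/
def SLP.Expr.word {σ i : ℕ} : SLP.Expr (Fin σ) i → Fin 3 → ℕ
  | .letter a => ![0, a, 0]
  | .pair l r => ![1, l, r]

/-- The initial state for an input program of size `n`: register `0` holds `n`, the arrays `0`,
`1` and `2` hold at index `i` the three words of the `i`-th assignment, and everything else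
is `0`. -/
def SLP.initState {σ : ℕ} (G : SLP (Fin σ)) : RAM.State where
  reg x := if x = 0 then G.size else 0
  arr b i := if h : b < 3 ∧ i < G.size then (G.rule ⟨i, h.2⟩).word ⟨b, h.1⟩ else 0

/-- The two words that describe an ID: `0, a` for a letter `a`, and `1, k` for the entry with
number `k`. -/
def LZ78.Id.word {σ : ℕ} : LZ78.Id (Fin σ) → Fin 2 → ℕ
  | .letter a => ![0, a]
  | .entry k => ![1, k]

/-- The state holds the sequence `ids` as its output: its length is in register `1`, and the two
words of the `i`-th ID are in the arrays `3` and `4` at index `i`. -/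
def RAM.State.Outputs {σ : ℕ} (s : RAM.State) (ids : List (LZ78.Id (Fin σ))) : Prop :=
  s.reg 1 = ids.length ∧
    ∀ (i : ℕ) (hi : i < ids.length), s.arr 3 i = ids[i].word 0 ∧ s.arr 4 i = ids[i].word 1

/-!
To find a factor, it suffices to know which dictionary entries are prefixes of the rest of the
text. The entry with number `k` is `f_k` followed by one letter, and `f_k` is itself a letter or
an earlier entry. So the entries can be marked as prefixes one after the other: the mark of an
entry is read off from an earlier mark and from a single letter of the text. This letter is found
in `O(n)` steps by descending in the straight line program along the lengths of the values of its
variables. There are `m` factors with at most `m` entries to mark for each, which takes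
`O(n m ^ 2)` time.
-/

/-! ### Greedy factorizations -/

namespace LZ78

variable {α : Type} {fs gs : List (List α)} {f g S T : List α} {a : α} {i k : ℕ}

theorem mem_dict_iff : g ∈ dict fs i ↔ (∃ a, g = [a]) ∨ ∃ k < i, g = entry fs k := by
  induction i with
  | zero => simp [dict]
  | succ i ih =>
    simp only [dict, Set.mem_union, ih, Set.mem_singleton_iff, or_assoc, Nat.exists_lt_succ_right]

theorem dict_congr (h : ∀ k < i, entry fs k = entry gs k) : dict fs i = dict gs i := by
  ext g
  simp only [mem_dict_iff]
  exact or_congr_right (exists_congr fun k => and_congr_right fun hk => by rw [h k hk])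

theorem entry_append_of_lt (h : k + 1 < fs.length) : entry (fs ++ gs) k = entry fs k := by
  rw [entry, entry, List.getD_append _ _ _ _ (Nat.lt_of_succ_lt h), List.getD_append _ _ _ _ h]

theorem dict_append_of_lt (h : i < fs.length) : dict (fs ++ gs) i = dict fs i :=
  dict_congr fun _ hk => entry_append_of_lt ((Nat.succ_le_of_lt hk).trans_lt h)

theorem entry_concat_congr (h : f.take 1 = g.take 1) (hk : k < fs.length) :
    entry (fs ++ [f]) k = entry (fs ++ [g]) k := by
  obtain hk' | hk' := (Nat.succ_le_of_lt hk).lt_or_eq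
  · rw [entry_append_of_lt hk', entry_append_of_lt hk']
  · simp [entry, ← hk', h]

theorem entry_eq (h : (fs.getD (k + 1) []).head? = some a) :
    entry fs k = fs.getD k [] ++ [a] := by
  rw [entry, List.take_one, h, Option.toList_some]

theorem concat_isPrefix_iff :
    f ++ [a] <+: T ↔ f <+: T ∧ T[f.length]? = some a := by
  refine ⟨fun h => ⟨(List.prefix_append f [a]).trans h, ?_⟩, ?_⟩
  · rw [List.prefix_iff_getElem?.1 h _ (by simp), List.getElem_concat_length rfl]
  · rintro ⟨⟨U, rfl⟩, ha⟩
    obtain _ | ⟨b, U⟩ := U <;> simp_all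

theorem entry_isPrefix_iff (h : (fs.getD (k + 1) []).head? = some a) :
    entry fs k <+: T ↔ fs.getD k [] <+: T ∧ T[(fs.getD k []).length]? = some a := by
  rw [entry_eq h, concat_isPrefix_iff]

/-- `f` is the longest prefix of `T` in the dictionary that contains the letters and the first `i`
entries. -/
def IsLongestMatch (fs : List (List α)) (i : ℕ) (T f : List α) : Prop :=
  f ∈ dict fs i ∧ f <+: T ∧ ∀ g ∈ dict fs i, g <+: T → g.length ≤ f.length

namespace IsLongestMatch

theorem zero (fs : List (List α)) (a : α) (T : List α) : IsLongestMatch fs 0 (a :: T) [a] := by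
  refine ⟨⟨a, rfl⟩, by simp, ?_⟩
  rintro _ ⟨b, rfl⟩ -
  rfl

theorem succ_of_le (h : IsLongestMatch fs i T f)
    (hle : entry fs i <+: T → (entry fs i).length ≤ f.length) : IsLongestMatch fs (i + 1) T f := by
  refine ⟨.inl h.1, h.2.1, ?_⟩
  rintro g (hg | rfl) hgT
  exacts [h.2.2 g hg hgT, hle hgT]

theorem succ_entry (h : IsLongestMatch fs i T f) (hT : entry fs i <+: T)
    (hle : f.length ≤ (entry fs i).length) : IsLongestMatch fs (i + 1) T (entry fs i) := by
  refine ⟨.inr rfl, hT, ?_⟩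
  rintro g (hg | rfl) hgT
  exacts [(h.2.2 g hg hgT).trans hle, le_rfl]

theorem eq (hf : IsLongestMatch fs i T f) (hg : IsLongestMatch fs i T g) : f = g :=
  (List.prefix_of_prefix_length_le hf.2.1 hg.2.1 (hg.2.2 f hf.1 hf.2.1)).eq_of_length
    (le_antisymm (hg.2.2 f hf.1 hf.2.1) (hf.2.2 g hg.1 hg.2.1))

theorem ne_nil (h : IsLongestMatch fs i T f) (hT : T ≠ []) : f ≠ [] := by
  obtain ⟨a, T, rfl⟩ := List.exists_cons_of_ne_nil hT
  exact List.length_pos_iff.1 (h.2.2 [a] (mem_dict_iff.2 (.inl ⟨a, rfl⟩)) (by simp))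

end IsLongestMatch

theorem exists_isLongestMatch (fs : List (List α)) (i : ℕ) (hT : T ≠ []) :
    ∃ f, IsLongestMatch fs i T f := by
  induction i with
  | zero =>
    obtain ⟨a, T, rfl⟩ := List.exists_cons_of_ne_nil hT
    exact ⟨[a], .zero fs a T⟩
  | succ i ih =>
    obtain ⟨f, hf⟩ := ih
    by_cases h : entry fs i <+: T ∧ f.length ≤ (entry fs i).length
    · exact ⟨_, hf.succ_entry h.1 h.2⟩
    · exact ⟨f, hf.succ_of_le fun hT => le_of_not_ge fun hle => h ⟨hT, hle⟩⟩

/-- `fs` is the beginning of an LZ78 factorization, with the suffix `T` left to be factorized. -/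
def IsGreedy (fs : List (List α)) (T : List α) : Prop :=
  ∀ (i : ℕ) (hi : i < fs.length), IsLongestMatch fs i ((fs.drop i).flatten ++ T) fs[i]

theorem drop_flatten_eq (hi : i < fs.length) :
    (fs.drop i).flatten = fs[i] ++ (fs.drop (i + 1)).flatten := by
  rw [List.drop_eq_getElem_cons hi, List.flatten_cons]

theorem isFactorization_iff_isGreedy : IsFactorization fs.flatten fs ↔ IsGreedy fs [] := by
  simp only [IsFactorization, IsGreedy, IsLongestMatch, true_and, List.append_nil]
  refine forall₂_congr fun i hi => and_congr_right fun _ => (and_iff_right ?_).symm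
  exact drop_flatten_eq hi ▸ List.prefix_append _ _

theorem IsGreedy.concat (h : IsGreedy fs (f ++ T))
    (hf : IsLongestMatch (fs ++ [f]) fs.length (f ++ T) f) : IsGreedy (fs ++ [f]) T := by
  intro i hi
  obtain hi' | rfl := Nat.lt_succ_iff_lt_or_eq.1 (List.length_append ▸ hi)
  · have := h i hi'
    simpa [IsLongestMatch, dict_append_of_lt hi', List.drop_append_of_le_length hi'.le,
      List.getElem_append_left hi'] using this
  · simpa using hf

theorem exists_isFactorization (S : List α) : ∃ fs, IsFactorization S fs := by
  suffices ∀ T fs, IsGreedy (α := α) fs T → ∃ gs, IsFactorization (fs.flatten ++ T) gs from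
    this S [] (by simp [IsGreedy])
  intro T
  induction hn : T.length using Nat.strong_induction_on generalizing T with
  | _ n ih =>
    intro fs hfs
    rcases T with _ | ⟨a, T⟩
    · exact ⟨fs, by simpa using isFactorization_iff_isGreedy.2 hfs⟩
    -- The dictionary from which the next factor is taken depends only on the first letter of it.
    obtain ⟨f, hf⟩ := exists_isLongestMatch (fs ++ [[a]]) fs.length (List.cons_ne_nil a T)
    have hf0 := hf.ne_nil (List.cons_ne_nil a T)
    obtain ⟨T', hT'⟩ := hf.2.1
    have hfa : [a].take 1 = f.take 1 := by
      rw [← List.take_append_of_le_length (List.length_pos_iff.2 hf0), hT', List.take_one]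
      rfl
    rw [IsLongestMatch, dict_congr fun k hk => entry_concat_congr hfa hk, ← hT'] at hf
    rw [← hT'] at hfs hn ⊢
    have hlt : T'.length < n := by
      rw [← hn, List.length_append]
      exact Nat.lt_add_of_pos_left (List.length_pos_iff.2 hf0)
    simpa using ih _ hlt T' rfl _ (hfs.concat hf)

namespace IsFactorization

theorem isLongestMatch (h : IsFactorization S fs) (hi : i < fs.length) :
    IsLongestMatch fs i (fs.drop i).flatten fs[i] := by
  have hfs := isFactorization_iff_isGreedy.1 ⟨rfl, h.2⟩ i hi
  rwa [List.append_nil] at hfs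

theorem getElem_ne_nil (h : IsFactorization S fs) (hi : i < fs.length) : fs[i] ≠ [] := by
  induction i using Nat.strong_induction_on with
  | _ i ih =>
    obtain ⟨a, ha⟩ | ⟨k, hk, hf⟩ := mem_dict_iff.1 (h.2 i hi).1
    · simp [ha]
    · simp [hf, entry, hk.trans hi, ih k hk (hk.trans hi)]

theorem drop_flatten_ne_nil_iff (h : IsFactorization S fs) (hi : i ≤ fs.length) :
    (fs.drop i).flatten ≠ [] ↔ i < fs.length := by
  refine ⟨fun hne => hi.lt_of_ne ?_, fun hi => ?_⟩
  · rintro rfl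
    simp at hne
  · simp [drop_flatten_eq hi, h.getElem_ne_nil hi]

theorem exists_drop_flatten_eq_cons (h : IsFactorization S fs) (hi : i < fs.length) :
    ∃ a T, (fs.drop i).flatten = a :: T ∧ (fs.getD i []).head? = some a := by
  obtain ⟨a, f, hf⟩ := List.exists_cons_of_ne_nil (h.getElem_ne_nil hi)
  exact ⟨a, f ++ (fs.drop (i + 1)).flatten, by simp [drop_flatten_eq hi, hf],
    by rw [List.getD_eq_getElem _ _ hi, hf, List.head?_cons]⟩

theorem length_entry (h : IsFactorization S fs) (hk : k + 1 < fs.length) :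
    (entry fs k).length = (fs.getD k []).length + 1 := by
  obtain ⟨a, -, -, ha⟩ := h.exists_drop_flatten_eq_cons hk
  rw [entry_eq ha, List.length_append, List.length_singleton]

theorem length_le (h : IsFactorization S fs) : fs.length ≤ S.length := by
  rw [← h.1, List.length_flatten, ← List.length_map (f := List.length)]
  refine List.length_le_sum_of_one_le _ fun n hn => ?_
  obtain ⟨f, hf, rfl⟩ := List.mem_map.1 hn
  obtain ⟨i, hi, rfl⟩ := List.mem_iff_getElem.1 hf
  exact List.length_pos_iff.2 (h.getElem_ne_nil hi)

end IsFactorization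

end LZ78

/-! ### Values of variables -/

namespace SLP

variable {α : Type} {σ i : ℕ}

section

variable {G : SLP α} {hi : i < G.size}

theorem val_of_letter {a : α} (h : G.rule ⟨i, hi⟩ = .letter a) : G.val i hi = [a] := by
  rw [val, h]

theorem val_of_pair {l r : Fin i} (h : G.rule ⟨i, hi⟩ = .pair l r) :
    G.val i hi = G.val l (l.isLt.trans hi) ++ G.val r (r.isLt.trans hi) := by
  rw [val, h]

theorem val_ne_nil (G : SLP α) (i : ℕ) (hi : i < G.size) : G.val i hi ≠ [] := by
  induction i using Nat.strong_induction_on with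
  | _ i ih =>
    cases h : G.rule ⟨i, hi⟩ with
    | letter a => simp [val_of_letter h]
    | pair l r => simp [val_of_pair h, ih l l.isLt]

end

section

variable {G : SLP (Fin σ)}

theorem exists_letter_of_initState (hi : i < G.size) (h : G.initState.arr 0 i = 0) :
    ∃ a, G.val i hi = [a] ∧ G.initState.arr 1 i = a := by
  cases hr : G.rule ⟨i, hi⟩ with
  | letter a => exact ⟨a, val_of_letter hr, by simp [initState, hi, hr, Expr.word]⟩
  | pair l r => simp [initState, hi, hr, Expr.word] at h

theorem exists_pair_of_initState (hi : i < G.size) (h : G.initState.arr 0 i ≠ 0) :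
    ∃ l r : Fin i, G.val i hi = G.val l (l.isLt.trans hi) ++ G.val r (r.isLt.trans hi) ∧
      G.initState.arr 1 i = l ∧ G.initState.arr 2 i = r := by
  cases hr : G.rule ⟨i, hi⟩ with
  | letter a => simp [initState, hi, hr, Expr.word] at h
  | pair l r => exact ⟨l, r, val_of_pair hr, by simp [initState, hi, hr, Expr.word]⟩

end

/-- The words below `W` suffice to address the variables of the program and the positions in its
text. -/
structure FitsWord (G : SLP α) (W : ℕ) : Prop where
  size_lt : G.size < W
  length_lt : G.str.length < W

theorem FitsWord.one_lt {G : SLP α} {W : ℕ} (h : G.FitsWord W) : 1 < W :=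
  (Nat.succ_le_of_lt G.size_pos).trans_lt h.size_lt

end SLP

/-! ### Time-bounded total correctness -/

namespace RAM

section Runs

variable {W : ℕ} {c c₁ c₂ : Cmd} {s : State} {T T' T₁ T₂ : ℕ} {Q Q' : State → Prop}
  {e e₁ e₂ : Expr} {p : Prop}

/-- Total correctness with a time bound: started in `s`, the program `c` halts within `T` steps in a
state that satisfies `Q`. -/
def Runs (W : ℕ) (c : Cmd) (s : State) (T : ℕ) (Q : State → Prop) : Prop :=
  ∃ s' t, Exec W c s s' t ∧ t ≤ T ∧ Q s'

namespace Runs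

theorem mono (h : Runs W c s T Q) (hT : T ≤ T') (hQ : ∀ s', Q s' → Q' s') :
    Runs W c s T' Q' := by
  obtain ⟨s', t, hs', ht, hQs'⟩ := h
  exact ⟨s', t, hs', ht.trans hT, hQ _ hQs'⟩

theorem of_le (hT : T ≤ T') (h : Runs W c s T Q) : Runs W c s T' Q :=
  h.mono hT fun _ => id

theorem skip (h : Q s) : Runs W .skip s 1 Q :=
  ⟨_, _, .skip s, le_rfl, h⟩

theorem assign {x : ℕ} (h : Q (s.setReg x (e.eval W s))) : Runs W (.assign x e) s (e.cost + 1) Q :=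
  ⟨_, _, .assign x e s, le_rfl, h⟩

theorem write {b : ℕ} (h : Q (s.setArr b (e₁.eval W s) (e₂.eval W s))) :
    Runs W (.write b e₁ e₂) s (e₁.cost + e₂.cost + 1) Q :=
  ⟨_, _, .write b e₁ e₂ s, le_rfl, h⟩

theorem seq (h₁ : Runs W c₁ s T₁ Q') (h₂ : ∀ s', Q' s' → Runs W c₂ s' T₂ Q) :
    Runs W (.seq c₁ c₂) s (T₁ + T₂) Q := by
  obtain ⟨s₁, t₁, hs₁, ht₁, hQ₁⟩ := h₁
  obtain ⟨s₂, t₂, hs₂, ht₂, hQ₂⟩ := h₂ s₁ hQ₁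
  exact ⟨s₂, _, .seq hs₁ hs₂, Nat.add_le_add ht₁ ht₂, hQ₂⟩

theorem assign_seq {x : ℕ} (h : Runs W c (s.setReg x (e.eval W s)) T Q) :
    Runs W (.seq (.assign x e) c) s (e.cost + 1 + T) Q :=
  seq (Q' := (· = s.setReg x (e.eval W s))) (assign rfl) fun _ hs' => hs' ▸ h

theorem write_seq {b : ℕ} (h : Runs W c (s.setArr b (e₁.eval W s) (e₂.eval W s)) T Q) :
    Runs W (.seq (.write b e₁ e₂) c) s (e₁.cost + e₂.cost + 1 + T) Q :=
  seq (Q' := (· = s.setArr b (e₁.eval W s) (e₂.eval W s))) (write rfl) fun _ hs' => hs' ▸ h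

theorem ite (hp : e.eval W s ≠ 0 ↔ p) (h₁ : p → Runs W c₁ s T₁ Q) (h₂ : ¬p → Runs W c₂ s T₂ Q) :
    Runs W (.ite e c₁ c₂) s (e.cost + 1 + max T₁ T₂) Q := by
  by_cases h : e.eval W s = 0
  · obtain ⟨s', t, hs', ht, hQ⟩ := h₂ fun h' => hp.2 h' h
    exact ⟨s', _, .ite_false h hs', Nat.add_le_add_left (ht.trans (le_max_right _ _)) _, hQ⟩
  · obtain ⟨s', t, hs', ht, hQ⟩ := h₁ (hp.1 h)
    exact ⟨s', _, .ite_true h hs', Nat.add_le_add_left (ht.trans (le_max_left _ _)) _, hQ⟩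

theorem while_of_decreasing {I : ℕ → State → Prop} {k : ℕ}
    (h : ∀ k s, I k s → e.eval W s ≠ 0 → Runs W c s T fun s' => ∃ k' < k, I k' s') (hs : I k s) :
    Runs W (.while e c) s ((k + 1) * (e.cost + 1 + T))
      fun s' => e.eval W s' = 0 ∧ ∃ k, I k s' := by
  induction k using Nat.strong_induction_on generalizing s with
  | _ k ih =>
    by_cases he : e.eval W s = 0
    · exact ⟨s, _, .while_false he, by nlinarith, he, k, hs⟩
    · obtain ⟨s₁, t₁, hs₁, ht₁, k', hk', hI⟩ := h k s hs he
      obtain ⟨s₂, t₂, hs₂, ht₂, hQ⟩ := ih k' hk' hI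
      refine ⟨s₂, _, .while_true he hs₁ hs₂, ?_, hQ⟩
      calc e.cost + 1 + t₁ + t₂
        _ ≤ e.cost + 1 + T + (k' + 1) * (e.cost + 1 + T) := by gcongr
        _ ≤ e.cost + 1 + T + k * (e.cost + 1 + T) := by gcongr; exact hk'
        _ = (k + 1) * (e.cost + 1 + T) := by ring

theorem while_lt {I : ℕ → State → Prop} {n : ℕ}
    (hcond : ∀ i ≤ n, ∀ s, I i s → (e.eval W s ≠ 0 ↔ i < n))
    (hbody : ∀ i < n, ∀ s, I i s → Runs W c s T (I (i + 1))) (hs : I 0 s) :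
    Runs W (.while e c) s ((n + 1) * (e.cost + 1 + T)) (I n) := by
  have hwhile := while_of_decreasing (W := W) (e := e) (c := c) (T := T) (k := n) (s := s)
    (I := fun k s => ∃ i, k + i = n ∧ I i s) ?_ ⟨0, rfl, hs⟩
  · refine hwhile.mono le_rfl ?_
    rintro s' ⟨he, k, i, hk, hI⟩
    have hi : ¬i < n := fun hi => (hcond i hi.le s' hI).2 hi he
    obtain rfl : i = n := by omega
    exact hI
  · rintro k s ⟨i, hk, hI⟩ he
    have hi := (hcond i (by omega) s hI).1 he
    exact (hbody i hi s hI).mono le_rfl fun s' hs' => ⟨k - 1, by omega, i + 1, by omega, hs'⟩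

end Runs

theorem Expr.eval_lt_ne_zero (hW : 1 < W) :
    (Expr.op .lt e₁ e₂).eval W s ≠ 0 ↔ e₁.eval W s < e₂.eval W s := by
  simp only [eval, Op.eval]
  split <;> simp_all [Nat.mod_eq_of_lt hW]

theorem Expr.eval_eq_ne_zero (hW : 1 < W) :
    (Expr.op .eq e₁ e₂).eval W s ≠ 0 ↔ e₁.eval W s = e₂.eval W s := by
  simp only [eval, Op.eval]
  split <;> simp_all [Nat.mod_eq_of_lt hW]

end Runs

namespace State

@[simp]
theorem reg_setReg (s : State) (x v y : ℕ) :
    (s.setReg x v).reg y = if y = x then v else s.reg y :=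
  Function.update_apply ..

@[simp]
theorem arr_setReg (s : State) (x v : ℕ) : (s.setReg x v).arr = s.arr :=
  rfl

@[simp]
theorem reg_setArr (s : State) (b j v : ℕ) : (s.setArr b j v).reg = s.reg :=
  rfl

@[simp]
theorem arr_setArr (s : State) (b j v b' j' : ℕ) :
    (s.setArr b j v).arr b' j' = if b' = b ∧ j' = j then v else s.arr b' j' := by
  by_cases hb : b' = b
  · subst hb
    simp [setArr, Function.update_apply]
  · simp [setArr, hb]

end State

/-! ### The program -/

/-! Records of factors are indexed by the number of the factor: a kind and a value that form its ID,
as in the output format, its length, and its first letter. The record of the factor to be found next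
holds the longest match so far. A nonzero mark in `matchArr` means that the entry is a prefix of the
rest of the text. -/

abbrev sizeReg : ℕ := 0
abbrev countReg : ℕ := 1
abbrev posReg : ℕ := 2
abbrev textLenReg : ℕ := 3
abbrev entryReg : ℕ := 4
abbrev varReg : ℕ := 5
abbrev offsetReg : ℕ := 6
abbrev letterReg : ℕ := 7

abbrev ruleKindArr : ℕ := 0
abbrev leftArr : ℕ := 1
abbrev rightArr : ℕ := 2
abbrev idKindArr : ℕ := 3
abbrev idValueArr : ℕ := 4
abbrev varLenArr : ℕ := 5
abbrev factorLenArr : ℕ := 6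
abbrev firstArr : ℕ := 7
abbrev matchArr : ℕ := 8

def computeLength : Cmd :=
  .ite (.read ruleKindArr (.reg varReg))
    (.write varLenArr (.reg varReg)
      (.op .add (.read varLenArr (.read leftArr (.reg varReg)))
        (.read varLenArr (.read rightArr (.reg varReg)))))
    (.write varLenArr (.reg varReg) (.const 1))

def loadText : Cmd :=
  .seq
    (.while (.op .lt (.reg varReg) (.reg sizeReg))
      (.seq computeLength (.assign varReg (.op .add (.reg varReg) (.const 1)))))
    (.assign textLenReg (.read varLenArr (.op .sub (.reg sizeReg) (.const 1))))

/-- Follows the letter at the position `offsetReg` of the value of `varReg` down to the variable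
whose value is this letter. -/
def descend : Cmd :=
  .while (.read ruleKindArr (.reg varReg))
    (.ite (.op .lt (.reg offsetReg) (.read varLenArr (.read leftArr (.reg varReg))))
      (.assign varReg (.read leftArr (.reg varReg)))
      (.seq
        (.assign offsetReg
          (.op .sub (.reg offsetReg) (.read varLenArr (.read leftArr (.reg varReg)))))
        (.assign varReg (.read rightArr (.reg varReg)))))

/-- Reads the letter of the text at the position given by `e` into `letterReg`. -/
def readLetter (e : Expr) : Cmd :=
  .seq (.assign offsetReg e)
    (.seq (.assign varReg (.op .sub (.reg sizeReg) (.const 1)))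
      (.seq descend (.assign letterReg (.read leftArr (.reg varReg)))))

/-- Records the match whose ID consists of the words `b` and `x` as the longest one so far. -/
def record (b x : ℕ) (len : Expr) : Cmd :=
  .seq (.write factorLenArr (.reg countReg) len)
    (.seq (.write idKindArr (.reg countReg) (.const b))
      (.write idValueArr (.reg countReg) (.reg x)))

/-- Starts the search for the next factor with its first letter as the longest match. -/
def startFactor : Cmd :=
  .seq (readLetter (.reg posReg))
    (.seq (.write firstArr (.reg countReg) (.reg letterReg))
      (.seq (record 0 letterReg (.const 1)) (.assign entryReg (.const 0))))

/-- Marks the entry in `entryReg` if the factor that begins it is a prefix of the rest of the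
text. -/
def testFactor : Cmd :=
  .ite (.read idKindArr (.reg entryReg))
    (.write matchArr (.reg entryReg) (.read matchArr (.read idValueArr (.reg entryReg))))
    (.write matchArr (.reg entryReg)
      (.op .eq (.read idValueArr (.reg entryReg)) (.read firstArr (.reg countReg))))

def rejectEntry : Cmd :=
  .write matchArr (.reg entryReg) (.const 0)

/-- Marks the entry in `entryReg`, given in `letterReg` the letter of the text with which its last
letter has to agree. -/
def testLetter : Cmd :=
  .ite (.op .eq (.reg letterReg) (.read firstArr (.op .add (.reg entryReg) (.const 1))))
    testFactor rejectEntry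

def testEntry : Cmd :=
  .ite (.op .lt (.read factorLenArr (.reg entryReg)) (.op .sub (.reg textLenReg) (.reg posReg)))
    (.seq (readLetter (.op .add (.reg posReg) (.read factorLenArr (.reg entryReg)))) testLetter)
    rejectEntry

/-- Makes the entry in `entryReg` the longest match if it is marked and longer than the matches
before. The entry is one letter longer than the factor in its record. -/
def selectEntry : Cmd :=
  .ite (.read matchArr (.reg entryReg))
    (.ite (.op .lt (.read factorLenArr (.reg entryReg)) (.read factorLenArr (.reg countReg)))
      .skip
      (record 1 entryReg (.op .add (.read factorLenArr (.reg entryReg)) (.const 1))))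
    .skip

def scanEntries : Cmd :=
  .while (.op .lt (.reg entryReg) (.reg countReg))
    (.seq testEntry (.seq selectEntry (.assign entryReg (.op .add (.reg entryReg) (.const 1)))))

def finishFactor : Cmd :=
  .seq (.assign posReg (.op .add (.reg posReg) (.read factorLenArr (.reg countReg))))
    (.assign countReg (.op .add (.reg countReg) (.const 1)))

def parseFactor : Cmd :=
  .seq startFactor (.seq scanEntries finishFactor)

/-- The algorithm: computes the LZ78 factorization of the text. -/
def lz78 : Cmd :=
  .seq loadText (.while (.op .lt (.reg posReg) (.reg textLenReg)) parseFactor)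

/-! ### Random access to the text -/

section Text

variable {σ W n v q : ℕ} {G : SLP (Fin σ)} {a : Fin σ} {s s' : State} {e : Expr}

/-- The state holds the assignments of `G` and the lengths, modulo `W`, of the values of its first
`n` variables. -/
structure Loaded (W : ℕ) (G : SLP (Fin σ)) (n : ℕ) (s : State) : Prop where
  size : s.reg sizeReg = G.size
  rules : ∀ b < 3, ∀ v, s.arr b v = G.initState.arr b v
  varLen : ∀ v < n, ∀ hv : v < G.size, s.arr varLenArr v = (G.val v hv).length % W

theorem Loaded.congr (h : Loaded W G n s) (hsize : s'.reg sizeReg = s.reg sizeReg)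
    (harr : ∀ b ∈ [ruleKindArr, leftArr, rightArr, varLenArr], ∀ v, s'.arr b v = s.arr b v) :
    Loaded W G n s' where
  size := hsize.trans h.size
  rules b hb v := (harr b (by grind) v).trans (h.rules b hb v)
  varLen v hvn hv := (harr _ (by simp) v).trans (h.varLen v hvn hv)

theorem runs_computeLength (h : Loaded W G n s) (hvar : s.reg varReg = n)
    (hn : n < G.size) :
    Runs W computeLength s 12 fun s' => s'.reg = s.reg ∧ Loaded W G (n + 1) s' := by
  subst hvar
  set v := s.reg varReg with hv
  have loaded {x : ℕ} (hx : x = (G.val v hn).length % W) :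
      Loaded W G (v + 1) (s.setArr varLenArr v x) := by
    refine ⟨h.size, fun b hb u => ?_, fun u huv hu => ?_⟩
    · rw [← h.rules b hb u, State.arr_setArr, if_neg (by grind)]
    · obtain huv | rfl := Nat.lt_succ_iff_lt_or_eq.1 huv
      · simpa [huv.ne] using h.varLen u huv hu
      · simp [hx]
  refine .ite (p := G.initState.arr 0 v ≠ 0) (T₁ := 9) (T₂ := 3) ?_
    (fun hkind => .write ⟨rfl, loaded ?_⟩) (fun hkind => .write ⟨rfl, loaded ?_⟩)
  · rw [← h.rules 0 (by decide), Expr.eval, Expr.eval]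
  · obtain ⟨l, r, hval, hl, hr⟩ := SLP.exists_pair_of_initState hn hkind
    simp [Expr.eval, Op.eval, ← hv, h.rules 1, h.rules 2, hl, hr, h.varLen l, h.varLen r, hval,
      l.isLt.trans hn, r.isLt.trans hn]
  · obtain ⟨a, hval, -⟩ := SLP.exists_letter_of_initState hn (not_not.1 hkind)
    simp [Expr.eval, hval]

theorem runs_loadText (hG : G.FitsWord W) :
    Runs W loadText G.initState (50 * G.size) fun s =>
      Loaded W G G.size s ∧ s.reg textLenReg = G.str.length ∧ s.reg countReg = 0 ∧
        s.reg posReg = 0 := by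
  have hn := G.size_pos
  have hW := hG.one_lt
  refine .of_le ?time ((Runs.while_lt (T := 16) (n := G.size) (I := fun i s =>
    Loaded W G i s ∧ s.reg varReg = i ∧ s.reg countReg = 0 ∧ s.reg posReg = 0)
    ?cond ?body ?start).seq fun s ⟨h, _, hcount, hpos⟩ => .assign ?textLen)
  case start => exact ⟨⟨rfl, fun _ _ _ => rfl, by simp⟩, rfl, rfl, rfl⟩
  case cond =>
    rintro i - s ⟨h, hvar, -⟩
    rw [Expr.eval_lt_ne_zero hW, Expr.eval, Expr.eval, hvar, h.size]
  case body =>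
    rintro i hi s ⟨h, hvar, hcount, hpos⟩
    refine (runs_computeLength h hvar hi).seq fun s' ⟨hreg, hs'⟩ => .assign ?_
    refine ⟨hs'.congr (by simp) (by simp), ?_, by simp [hreg, hcount], by simp [hreg, hpos]⟩
    simp [Expr.eval, Op.eval, hreg, hvar,
      Nat.mod_eq_of_lt ((Nat.succ_le_of_lt hi).trans_lt hG.size_lt)]
  case textLen =>
    refine ⟨h.congr (by simp) (by simp), ?_, by simpa using hcount, by simpa using hpos⟩
    have hlen := h.varLen (G.size - 1) (Nat.sub_lt hn Nat.one_pos) (Nat.sub_lt hn Nat.one_pos)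
    rw [← SLP.str, Nat.mod_eq_of_lt hG.length_lt] at hlen
    simp [Expr.eval, Op.eval, h.size, Nat.mod_eq_of_lt, hW,
      (Nat.sub_le _ _).trans_lt hG.size_lt, hlen]
  case time =>
    simp only [Expr.cost]
    omega

/-- The letter at the position `q` of the value of `X_v` is `a`, and the positions of this value are
words. -/
def LetterAt (G : SLP (Fin σ)) (W v q : ℕ) (a : Fin σ) : Prop :=
  ∃ hv : v < G.size, (G.val v hv).length < W ∧ (G.val v hv)[q]? = some a

namespace LetterAt

theorem of_str (hG : G.FitsWord W) (h : G.str[q]? = some a) : LetterAt G W (G.size - 1) q a :=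
  ⟨Nat.sub_lt G.size_pos Nat.one_pos, hG.length_lt, h⟩

theorem eq_of_singleton {b : Fin σ} {hv : v < G.size} (h : LetterAt G W v q a)
    (hval : G.val v hv = [b]) : b = a := by
  obtain ⟨_, _, hq⟩ := h
  rw [hval, List.getElem?_singleton, Option.ite_none_right_eq_some] at hq
  exact Option.some_inj.1 hq.2

section Append

variable {l r : ℕ} {hv : v < G.size} {hl : l < G.size} {hr : r < G.size}

theorem length_left_lt (h : LetterAt G W v q a) (hval : G.val v hv = G.val l hl ++ G.val r hr) :
    (G.val l hl).length < W := by
  obtain ⟨_, hW, _⟩ := h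
  rw [hval, List.length_append] at hW
  omega

theorem left (h : LetterAt G W v q a) (hval : G.val v hv = G.val l hl ++ G.val r hr)
    (hq : q < (G.val l hl).length) : LetterAt G W l q a := by
  refine ⟨hl, h.length_left_lt hval, ?_⟩
  obtain ⟨_, _, ha⟩ := h
  rwa [hval, List.getElem?_append_left hq] at ha

theorem right (h : LetterAt G W v q a) (hval : G.val v hv = G.val l hl ++ G.val r hr)
    (hq : (G.val l hl).length ≤ q) : LetterAt G W r (q - (G.val l hl).length) a := by
  obtain ⟨_, hW, ha⟩ := h
  rw [hval, List.length_append] at hW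
  exact ⟨hr, by omega, by rwa [hval, List.getElem?_append_right hq] at ha⟩

end Append

theorem lt (h : LetterAt G W v q a) : q < W := by
  obtain ⟨_, hW, ha⟩ := h
  exact (List.getElem?_eq_some_iff.1 ha).1.trans hW

end LetterAt

theorem runs_descend (hW : 1 < W) (h : Loaded W G G.size s)
    (ha : LetterAt G W (s.reg varReg) (s.reg offsetReg) a) :
    Runs W descend s (18 * G.size) fun s' =>
      s'.arr = s.arr ∧ (∀ x < 5, s'.reg x = s.reg x) ∧ s'.arr leftArr (s'.reg varReg) = a := by
  refine ((Runs.while_of_decreasing (T := 15) (k := s.reg varReg) (I := fun v s' =>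
    s'.arr = s.arr ∧ (∀ x < 5, s'.reg x = s.reg x) ∧ s'.reg varReg = v ∧
      LetterAt G W v (s'.reg offsetReg) a) ?step ⟨rfl, fun _ _ => rfl, rfl, ha⟩)).mono ?time ?exit
  case time =>
    have := Nat.succ_le_of_lt ha.1
    simp only [Expr.cost]
    omega
  case exit =>
    rintro s' ⟨hkind, v, harr, hreg, rfl, hv⟩
    rw [Expr.eval, Expr.eval, harr, h.rules 0 (by decide)] at hkind
    obtain ⟨b, hval, hb⟩ := SLP.exists_letter_of_initState hv.1 hkind
    exact ⟨harr, hreg, by rw [harr, h.rules 1 (by decide), hb, hv.eq_of_singleton hval]⟩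
  case step =>
    rintro v s' ⟨harr, hreg, rfl, hv⟩ hkind
    rw [Expr.eval, Expr.eval, harr, h.rules 0 (by decide)] at hkind
    obtain ⟨l, r, hval, hleft, hright⟩ := SLP.exists_pair_of_initState hv.1 hkind
    have hlen := h.varLen l (l.isLt.trans hv.1) (l.isLt.trans hv.1)
    rw [Nat.mod_eq_of_lt (hv.length_left_lt hval)] at hlen
    rw [← h.rules _ (by decide), ← harr] at hleft hright
    rw [← harr] at hlen
    refine .ite (T₁ := 3) (T₂ := 9) (Expr.eval_lt_ne_zero hW)
      (fun hlt => .assign ⟨l, l.isLt, harr, ?_, ?_, ?_⟩)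
      (fun hge => .assign_seq (.assign ⟨r, r.isLt, harr, ?_, ?_, ?_⟩))
    · grind [State.reg_setReg]
    · simp [Expr.eval, hleft]
    · simp only [Expr.eval, hleft, hlen] at hlt
      exact hv.left hval hlt
    · grind [State.reg_setReg]
    · simp [Expr.eval, hright]
    · simp only [Expr.eval, hleft, hlen] at hge
      simpa [Expr.eval, Op.eval, hleft, hlen, Nat.mod_eq_of_lt ((Nat.sub_le _ _).trans_lt hv.lt)]
        using hv.right hval (not_lt.1 hge)

theorem runs_readLetter (hG : G.FitsWord W) (h : Loaded W G G.size s)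
    (ha : G.str[e.eval W s]? = some a) :
    Runs W (readLetter e) s (e.cost + 26 * G.size) fun s' =>
      s'.arr = s.arr ∧ (∀ x < 5, s'.reg x = s.reg x) ∧ s'.reg letterReg = a := by
  have hlast : (G.size - 1) % W = G.size - 1 :=
    Nat.mod_eq_of_lt ((Nat.sub_le _ _).trans_lt hG.size_lt)
  refine .of_le ?time (.assign_seq (.assign_seq
    ((runs_descend (G := G) (a := a) hG.one_lt ?loaded ?letter).seq fun s' hs' => .assign ?_)))
  case loaded => exact h.congr (by simp) (by simp)
  case letter =>
    simpa [Expr.eval, Op.eval, h.size, Nat.mod_eq_of_lt hG.one_lt, hlast]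
      using LetterAt.of_str hG ha
  case time =>
    have := G.size_pos
    simp only [Expr.cost]
    omega
  obtain ⟨harr, hreg, hletter⟩ := hs'
  refine ⟨harr, fun x hx => ?_, by simpa [Expr.eval] using hletter⟩
  grind [State.reg_setReg]

end Text

/-! ### Finding the factors -/

section Parsing

open LZ78

variable {σ W i j k x b : ℕ} {G : SLP (Fin σ)} {fs : List (List (Fin σ))} {f : List (Fin σ)}
  {a : Fin σ} {s s' : State} {len : Expr}

/-- The record at index `j` describes the element `f` of the dictionary of the letters and the first
`k` entries: it consists of the two words of an ID of `f` and of the length of `f`. -/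
def HasRecord (s : State) (j : ℕ) (fs : List (List (Fin σ))) (k : ℕ) (f : List (Fin σ)) : Prop :=
  ∃ x : LZ78.Id (Fin σ), x.Denotes fs k f ∧ s.arr idKindArr j = x.word 0 ∧
    s.arr idValueArr j = x.word 1 ∧ s.arr factorLenArr j = f.length

theorem HasRecord.congr (h : HasRecord s j fs k f)
    (harr : ∀ b ∈ [idKindArr, idValueArr, factorLenArr], s'.arr b j = s.arr b j) :
    HasRecord s' j fs k f := by
  obtain ⟨x, hx, hkind, hvalue, hlen⟩ := h
  simp only [List.forall_mem_cons] at harr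
  exact ⟨x, hx, harr.1.trans hkind, harr.2.1.trans hvalue, harr.2.2.1.trans hlen⟩

theorem HasRecord.succ (h : HasRecord s j fs k f) : HasRecord s j fs (k + 1) f := by
  obtain ⟨a | l, hx, h⟩ := h
  exacts [⟨.letter a, hx, h⟩, ⟨.entry l, ⟨Nat.lt_succ_of_lt hx.1, hx.2⟩, h⟩]

theorem runs_record {y : LZ78.Id (Fin σ)} (hy : y.Denotes fs k f) (hkind : b % W = y.word 0)
    (hvalue : s.reg x = y.word 1) (hlen : len.eval W s = f.length) :
    Runs W (record b x len) s (len.cost + 8) fun s' => s'.reg = s.reg ∧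
      (∀ b j, b ∉ [idKindArr, idValueArr, factorLenArr] ∨ j ≠ s.reg countReg →
        s'.arr b j = s.arr b j) ∧ HasRecord s' (s.reg countReg) fs k f := by
  refine .of_le ?time (.write_seq (.write_seq (.write ⟨rfl, ?frame, y, hy, ?_⟩)))
  case time =>
    simp only [Expr.cost]
    omega
  case frame =>
    intro b j h
    simp only [Expr.eval, State.reg_setArr, State.arr_setArr]
    grind
  simp [Expr.eval, hkind, hvalue, hlen]

/-- The first `i` factors of `fs` have been found. -/
structure Parsed (W : ℕ) (G : SLP (Fin σ)) (fs : List (List (Fin σ))) (i : ℕ) (s : State) :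
    Prop where
  loaded : Loaded W G G.size s
  textLen : s.reg textLenReg = G.str.length
  count : s.reg countReg = i
  rest : G.str.drop (s.reg posReg) = (fs.drop i).flatten
  records : ∀ j < i, HasRecord s j fs j (fs.getD j [])
  first : ∀ j < i, ∀ a, (fs.getD j []).head? = some a → s.arr firstArr j = a

/-- The first `i` factors of `fs` and the longest match `f` for the next factor among the letters
and the first `k` entries have been found. -/
structure Scanning (W : ℕ) (G : SLP (Fin σ)) (fs : List (List (Fin σ))) (i k : ℕ)
    (f : List (Fin σ)) (s : State) : Prop extends Parsed W G fs i s where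
  first_self : ∀ a, (fs.getD i []).head? = some a → s.arr firstArr i = a
  record : HasRecord s i fs k f
  longest : IsLongestMatch fs k (fs.drop i).flatten f
  isMatch : ∀ l < k, s.arr matchArr l ≠ 0 ↔ entry fs l <+: (fs.drop i).flatten

theorem Parsed.congr (h : Parsed W G fs i s) (hreg : ∀ x < 4, s'.reg x = s.reg x)
    (htext : ∀ b ∈ [ruleKindArr, leftArr, rightArr, varLenArr], ∀ v, s'.arr b v = s.arr b v)
    (harr : ∀ b < 8, ∀ j < i, s'.arr b j = s.arr b j) : Parsed W G fs i s' where
  loaded := h.loaded.congr (hreg _ (by decide)) htext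
  textLen := (hreg _ (by decide)).trans h.textLen
  count := (hreg _ (by decide)).trans h.count
  rest := hreg posReg (by decide) ▸ h.rest
  records j hj := (h.records j hj).congr fun b hb => harr b (by grind) j hj
  first j hj a ha := (harr _ (by decide) j hj).trans (h.first j hj a ha)

theorem Parsed.getElem?_rest (h : Parsed W G fs i s) (q : ℕ) :
    (fs.drop i).flatten[q]? = G.str[s.reg posReg + q]? := by
  rw [← h.rest, List.getElem?_drop]

theorem Parsed.length_rest (h : Parsed W G fs i s) :
    (fs.drop i).flatten.length = G.str.length - s.reg posReg := by
  rw [← h.rest, List.length_drop]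

theorem Parsed.length_rest_lt (hG : G.FitsWord W) (h : Parsed W G fs i s) :
    (fs.drop i).flatten.length < W :=
  h.length_rest.trans_le (Nat.sub_le _ _) |>.trans_lt hG.length_lt

theorem add_one_mod_of_lt_length (hG : G.FitsWord W) (hfs : IsFactorization G.str fs)
    (hi : i < fs.length) : (i + 1) % W = i + 1 :=
  Nat.mod_eq_of_lt (lt_of_le_of_lt (hi.trans_le hfs.length_le) hG.length_lt)

theorem Scanning.congr (h : Scanning W G fs i k f s) (hreg : ∀ x < 4, s'.reg x = s.reg x)
    (harr : ∀ b < 8, ∀ j, s'.arr b j = s.arr b j)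
    (hmatch : ∀ l < k, s'.arr matchArr l = s.arr matchArr l) : Scanning W G fs i k f s' where
  toParsed := h.toParsed.congr hreg (fun b hb => harr b (by grind)) fun b hb j _ => harr b hb j
  first_self a ha := (harr _ (by decide) i).trans (h.first_self a ha)
  record := h.record.congr fun b hb => harr b (by grind) i
  longest := h.longest
  isMatch l hl := hmatch l hl ▸ h.isMatch l hl

theorem runs_startFactor (hG : G.FitsWord W) (hfs : IsFactorization G.str fs)
    (h : Parsed W G fs i s) (hi : i < fs.length) :
    Runs W startFactor s (41 * G.size) fun s' =>
      (∃ f, Scanning W G fs i 0 f s') ∧ s'.reg entryReg = 0 := by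
  have hW := hG.one_lt
  obtain ⟨a, T, hT, hfirst⟩ := hfs.exists_drop_flatten_eq_cons hi
  have ha : G.str[s.reg posReg]? = some a :=
    (h.getElem?_rest 0).symm.trans (by rw [hT, List.getElem?_cons_zero])
  refine .of_le ?time ((runs_readLetter (e := .reg _) hG h.loaded ha).seq
    fun s₁ ⟨harr₁, hreg₁, hletter⟩ => .write_seq
      ((runs_record (f := [a]) (k := 0) (fs := fs) (y := .letter a) rfl ?_ ?_ ?_).seq
      fun s₂ ⟨hreg₂, harr₂, hrecord⟩ => .assign ⟨⟨[a], ?_⟩, ?_⟩))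
  case time =>
    have := G.size_pos
    simp only [Expr.cost]
    omega
  · simp [Id.word]
  · simp [Id.word, hletter]
  · simp [Expr.eval, Nat.mod_eq_of_lt hW]
  · have hcount : s₁.reg countReg = i := (hreg₁ _ (by decide)).trans h.count
    simp only [State.reg_setArr, Expr.eval, hcount, hletter] at hreg₂ harr₂ hrecord
    have harr : ∀ b < 8, ∀ j, b ∉ [idKindArr, idValueArr, factorLenArr, firstArr] ∨ j ≠ i →
        s₂.arr b j = s.arr b j := fun b _ j hj => by
      rw [harr₂ b j (by grind), State.arr_setArr, if_neg (by grind), harr₁]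
    refine ⟨h.congr ?_ (fun b _ v => harr b (by grind) v (by grind))
      fun b hb j hj => harr b hb j (.inr hj.ne), ?_, ?_, hT ▸ .zero fs a T, by simp⟩
    · grind [State.reg_setReg]
    · intro b hb
      obtain rfl : a = b := Option.some_inj.1 (hfirst.symm.trans hb)
      rw [State.arr_setReg, harr₂ _ _ (by grind), State.arr_setArr, if_pos ⟨rfl, rfl⟩]
    · exact hrecord.congr (by simp)
  · simp [Expr.eval]

theorem runs_writeMatch {p : Prop} {e : Expr} (h : Scanning W G fs i k f s)
    (hk : s.reg entryReg = k) (hp : e.eval W s ≠ 0 ↔ p) :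
    Runs W (.write matchArr (.reg entryReg) e) s (e.cost + 2) fun s' =>
      Scanning W G fs i k f s' ∧ s'.reg entryReg = k ∧ (s'.arr matchArr k ≠ 0 ↔ p) := by
  refine .of_le ?time (.write ⟨h.congr (fun _ _ => rfl) ?_ ?_, hk, ?_⟩)
  case time =>
    simp only [Expr.cost]
    omega
  · intro b hb j
    rw [State.arr_setArr, if_neg (by grind)]
  · intro l hl
    rw [State.arr_setArr, if_neg (by grind [Expr.eval])]
  · simpa [Expr.eval, hk] using hp

theorem runs_testFactor (hW : 1 < W) (hfs : IsFactorization G.str fs)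
    (h : Scanning W G fs i k f s) (hk : s.reg entryReg = k) (hki : k < i) (hi : i < fs.length) :
    Runs W testFactor s 10 fun s' =>
      Scanning W G fs i k f s' ∧ s'.reg entryReg = k ∧
        (s'.arr matchArr k ≠ 0 ↔ fs.getD k [] <+: (fs.drop i).flatten) := by
  obtain ⟨x, hx, hkind, hvalue, -⟩ := h.records k hki
  refine .ite (p := ∃ l, x = .entry l) (T₁ := 5) (T₂ := 7) ?_
    (fun hxl => runs_writeMatch h hk ?_) (fun hxl => runs_writeMatch h hk ?_)
  · cases x <;> simp [Expr.eval, hk, hkind, Id.word]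
  · obtain ⟨l, rfl⟩ := hxl
    rw [hx.2]
    simpa [Expr.eval, hk, hvalue, Id.word] using h.isMatch l hx.1
  · obtain ⟨b, T, hT, hb⟩ := hfs.exists_drop_flatten_eq_cons hi
    have hfirst : s.arr firstArr i = b := h.first_self b hb
    obtain a | l := x
    · rw [Expr.eval_eq_ne_zero hW, hT, hx, List.cons_prefix_cons]
      simp [Expr.eval, hk, hvalue, h.count, hfirst, Id.word, Fin.val_inj]
    · exact absurd ⟨l, rfl⟩ hxl

theorem runs_testLetter (hG : G.FitsWord W) (hfs : IsFactorization G.str fs)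
    (h : Scanning W G fs i k f s) (hk : s.reg entryReg = k) (hki : k < i) (hi : i < fs.length)
    (ha : (fs.getD (k + 1) []).head? = some a) {b : Fin σ} (hletter : s.reg letterReg = b) :
    Runs W testLetter s 17 fun s' =>
      Scanning W G fs i k f s' ∧ s'.reg entryReg = k ∧
        (s'.arr matchArr k ≠ 0 ↔ fs.getD k [] <+: (fs.drop i).flatten ∧ b = a) := by
  have hW := hG.one_lt
  have hki' : k + 1 ≤ i := hki
  have hk1 := add_one_mod_of_lt_length hG hfs (hki.trans hi)
  have hfirst : s.arr firstArr (k + 1) = a := by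
    obtain hlt | rfl := hki'.lt_or_eq
    exacts [h.first _ hlt a ha, h.first_self a ha]
  refine .ite (p := b = a) (T₁ := 10) (T₂ := 3) ?_
    (fun hba => ?_) (fun hba => runs_writeMatch h hk (by simp [Expr.eval, hba]))
  · rw [Expr.eval_eq_ne_zero hW]
    simp [Expr.eval, Op.eval, hk, hletter, hk1, hfirst, Nat.mod_eq_of_lt hW, Fin.val_inj]
  · simpa only [hba, and_true] using runs_testFactor hW hfs h hk hki hi

theorem runs_testEntry (hG : G.FitsWord W) (hfs : IsFactorization G.str fs)
    (h : Scanning W G fs i k f s) (hk : s.reg entryReg = k) (hki : k < i) (hi : i < fs.length) :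
    Runs W testEntry s (54 * G.size) fun s' =>
      Scanning W G fs i k f s' ∧ s'.reg entryReg = k ∧
        (s'.arr matchArr k ≠ 0 ↔ entry fs k <+: (fs.drop i).flatten) := by
  obtain ⟨a, -, -, ha⟩ := hfs.exists_drop_flatten_eq_cons ((Nat.succ_le_of_lt hki).trans_lt hi)
  obtain ⟨-, -, -, -, hlen⟩ := h.records k hki
  have hnext := h.getElem?_rest (fs.getD k []).length
  simp only [entry_isPrefix_iff ha]
  generalize (fs.getD k []).length = q at hlen hnext ⊢
  refine .of_le ?time (.ite (p := q < (fs.drop i).flatten.length) ?cond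
    (fun hlt => (runs_readLetter hG h.loaded (a := (fs.drop i).flatten[q]) ?letter).seq
      (T₂ := 17) fun s₁ ⟨harr, hreg, hletter⟩ => ?_)
    fun hge => runs_writeMatch h hk ?short)
  case cond =>
    have hrest := h.length_rest_lt hG
    rw [Expr.eval_lt_ne_zero hG.one_lt]
    simp only [Expr.eval, Op.eval, hk, hlen, h.textLen, ← h.length_rest, Nat.mod_eq_of_lt hrest]
  case short => simp [Expr.eval, List.getElem?_eq_none (not_lt.1 hge)]
  case letter =>
    rw [List.getElem?_eq_getElem hlt] at hnext
    have hpos := (List.getElem?_eq_some_iff.1 hnext.symm).1.trans hG.length_lt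
    simpa [Expr.eval, Op.eval, hk, hlen, Nat.mod_eq_of_lt hpos] using hnext.symm
  case time =>
    have := G.size_pos
    simp only [Expr.cost]
    omega
  have h₁ : Scanning W G fs i k f s₁ :=
    h.congr (fun x _ => hreg x (by omega)) (by simp [harr]) (by simp [harr])
  rw [List.getElem?_eq_getElem hlt, Option.some_inj]
  exact runs_testLetter hG hfs h₁ ((hreg _ (by decide)).trans hk) hki hi ha hletter

theorem Scanning.isMatch_succ (h : Scanning W G fs i k f s)
    (hmatch : s.arr matchArr k ≠ 0 ↔ entry fs k <+: (fs.drop i).flatten) :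
    ∀ l < k + 1, s.arr matchArr l ≠ 0 ↔ entry fs l <+: (fs.drop i).flatten :=
  fun l hl => (Nat.lt_succ_iff_lt_or_eq.1 hl).elim (h.isMatch l) fun hl => hl ▸ hmatch

theorem Scanning.succ_of_le (h : Scanning W G fs i k f s)
    (hmatch : s.arr matchArr k ≠ 0 ↔ entry fs k <+: (fs.drop i).flatten)
    (hle : entry fs k <+: (fs.drop i).flatten → (entry fs k).length ≤ f.length) :
    Scanning W G fs i (k + 1) f s :=
  ⟨h.toParsed, h.first_self, h.record.succ, h.longest.succ_of_le hle, h.isMatch_succ hmatch⟩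

theorem runs_recordEntry (hW : 1 < W) (h : Scanning W G fs i k f s) (hk : s.reg entryReg = k)
    (hmatch : s.arr matchArr k ≠ 0 ↔ entry fs k <+: (fs.drop i).flatten)
    (hT : entry fs k <+: (fs.drop i).flatten) (hle : f.length ≤ (entry fs k).length)
    (hlen : len.eval W s = (entry fs k).length) :
    Runs W (record 1 entryReg len) s (len.cost + 8) fun s' =>
      (∃ f, Scanning W G fs i (k + 1) f s') ∧ s'.reg entryReg = k := by
  refine (runs_record (y := .entry k) ⟨k.lt_succ_self, rfl⟩ (Nat.mod_eq_of_lt hW) hk hlen).mono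
    le_rfl fun s' ⟨hreg, harr, hrecord⟩ => ⟨⟨entry fs k, ?_⟩, hreg ▸ hk⟩
  rw [h.count] at harr hrecord
  refine ⟨h.toParsed.congr (fun x _ => hreg ▸ rfl) (fun b _ v => harr b v (by grind))
    (fun b _ j hj => harr b j (.inr hj.ne)), fun a ha => ?_, hrecord,
    h.longest.succ_entry hT hle, fun l hl => ?_⟩
  · rw [harr _ _ (.inl (by decide)), h.first_self a ha]
  · rw [harr _ _ (.inl (by decide)), h.isMatch_succ hmatch l hl]

theorem runs_selectEntry (hG : G.FitsWord W) (hfs : IsFactorization G.str fs)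
    (h : Scanning W G fs i k f s) (hk : s.reg entryReg = k) (hki : k < i) (hi : i < fs.length)
    (hmatch : s.arr matchArr k ≠ 0 ↔ entry fs k <+: (fs.drop i).flatten) :
    Runs W selectEntry s 21 fun s' =>
      (∃ f, Scanning W G fs i (k + 1) f s') ∧ s'.reg entryReg = k := by
  have hW := hG.one_lt
  have hentry := hfs.length_entry ((Nat.succ_le_of_lt hki).trans_lt hi)
  obtain ⟨-, -, -, -, hlen⟩ := h.records k hki
  obtain ⟨-, -, -, -, hlen'⟩ := h.record
  refine .ite (p := entry fs k <+: (fs.drop i).flatten) (T₁ := 18) (T₂ := 1) ?_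
    (fun hT => .ite (p := (entry fs k).length ≤ f.length) (T₁ := 1) (T₂ := 12) ?_
      (fun hle => .skip ⟨⟨f, h.succ_of_le hmatch fun _ => hle⟩, hk⟩)
      (fun hle => runs_recordEntry hW h hk hmatch hT (le_of_not_ge hle) ?_))
    (fun hT => .skip ⟨⟨f, h.succ_of_le hmatch (absurd · hT)⟩, hk⟩)
  · simpa only [Expr.eval, hk] using hmatch
  · rw [Expr.eval_lt_ne_zero hW]
    simp only [Expr.eval, hk, hlen, h.count, hlen', hentry, Nat.succ_le_iff]
  · have hlt := hT.length_le.trans_lt (h.length_rest_lt hG)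
    simp only [Expr.eval, Op.eval, hk, hlen, Nat.mod_eq_of_lt hW, ← hentry, Nat.mod_eq_of_lt hlt]

theorem runs_scanEntries (hG : G.FitsWord W) (hfs : IsFactorization G.str fs)
    (h : Scanning W G fs i 0 f s) (hk : s.reg entryReg = 0) (hi : i < fs.length) :
    Runs W scanEntries s (84 * (G.size * fs.length)) fun s' => ∃ f, Scanning W G fs i i f s' := by
  refine ((Runs.while_lt (T := 54 * G.size + 25) (n := i) (I := fun k s =>
    (∃ f, Scanning W G fs i k f s) ∧ s.reg entryReg = k) ?cond ?body ⟨⟨f, h⟩, hk⟩)).mono ?time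
      fun s' hs' => hs'.1
  case cond =>
    rintro k - s ⟨⟨f, h⟩, hk⟩
    rw [Expr.eval_lt_ne_zero hG.one_lt, Expr.eval, Expr.eval, hk, h.count]
  case body =>
    rintro k hki s ⟨⟨f, h⟩, hk⟩
    refine (runs_testEntry hG hfs h hk hki hi).seq fun s₁ ⟨h₁, hk₁, hmatch⟩ =>
      (runs_selectEntry hG hfs h₁ hk₁ hki hi hmatch).seq fun s₂ ⟨⟨f₂, h₂⟩, hk₂⟩ =>
      .assign ⟨⟨f₂, h₂.congr (by grind [State.reg_setReg]) (by simp) (by simp)⟩, ?_⟩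
    simp [Expr.eval, Op.eval, hk₂, Nat.mod_eq_of_lt hG.one_lt,
      add_one_mod_of_lt_length hG hfs (hki.trans hi)]
  case time =>
    have := G.size_pos
    simp only [Expr.cost]
    nlinarith

theorem runs_finishFactor (hG : G.FitsWord W) (hfs : IsFactorization G.str fs)
    (h : Scanning W G fs i i f s) (hi : i < fs.length) :
    Runs W finishFactor s 9 (Parsed W G fs (i + 1)) := by
  have hrest := h.length_rest
  have hfi := drop_flatten_eq hi
  obtain rfl := h.longest.eq (hfs.isLongestMatch hi)
  obtain ⟨-, -, -, -, hlen⟩ := h.record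
  have hpos : (s.reg posReg + fs[i].length) % W = s.reg posReg + fs[i].length := by
    have hpos := List.length_pos_iff.2 (hfs.getElem_ne_nil hi)
    have hlt := hG.length_lt
    rw [hfi, List.length_append] at hrest
    exact Nat.mod_eq_of_lt (by omega)
  refine .assign_seq (.assign ⟨h.loaded.congr (by simp) (by simp), by simpa using h.textLen,
    ?count, ?rest, fun j hj => ?records, fun j hj a ha => ?first⟩)
  case count =>
    simp [Expr.eval, Op.eval, h.count, Nat.mod_eq_of_lt hG.one_lt,
      add_one_mod_of_lt_length hG hfs hi]
  case rest =>
    have hrest' : G.str.drop (s.reg posReg + fs[i].length) = (fs.drop (i + 1)).flatten := by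
      rw [← List.drop_drop, h.rest, hfi, List.drop_left]
    simpa [Expr.eval, Op.eval, h.count, hlen, hpos] using hrest'
  case records =>
    refine HasRecord.congr ?_ fun _ _ => rfl
    obtain hj | rfl := Nat.lt_succ_iff_lt_or_eq.1 hj
    exacts [h.records j hj, List.getD_eq_getElem _ _ hi ▸ h.record]
  case first =>
    obtain hj | rfl := Nat.lt_succ_iff_lt_or_eq.1 hj
    exacts [h.first j hj a ha, h.first_self a ha]

theorem runs_parseFactor (hG : G.FitsWord W) (hfs : IsFactorization G.str fs)
    (h : Parsed W G fs i s) (hi : i < fs.length) :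
    Runs W parseFactor s (134 * (G.size * fs.length)) (Parsed W G fs (i + 1)) := by
  refine .of_le ?time ((runs_startFactor hG hfs h hi).seq fun s₁ ⟨⟨f₁, h₁⟩, hk⟩ =>
    (runs_scanEntries hG hfs h₁ hk hi).seq fun s₂ ⟨f₂, h₂⟩ => runs_finishFactor hG hfs h₂ hi)
  have := Nat.mul_le_mul_left G.size (Nat.one_le_of_lt hi)
  have := G.size_pos
  omega

theorem runs_lz78 (hG : G.FitsWord W) (hfs : IsFactorization G.str fs) :
    Runs W lz78 G.initState (326 * (G.size * fs.length ^ 2)) (Parsed W G fs fs.length) := by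
  have hlen : 0 < fs.length :=
    (hfs.drop_flatten_ne_nil_iff (Nat.zero_le _)).1 (hfs.1 ▸ SLP.val_ne_nil G _ _)
  refine .of_le ?time ((runs_loadText hG).seq fun s ⟨hloaded, htextLen, hcount, hpos⟩ =>
    .while_lt (I := Parsed W G fs) ?cond (fun i hi s h => runs_parseFactor hG hfs h hi) ?start)
  case start =>
    exact ⟨hloaded, htextLen, hcount, by simp [hpos, hfs.1], by simp, by simp⟩
  case cond =>
    intro i hi s h
    rw [Expr.eval_lt_ne_zero hG.one_lt, Expr.eval, Expr.eval, h.textLen,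
      ← hfs.drop_flatten_ne_nil_iff hi, ← h.rest, Ne, List.drop_eq_nil_iff, not_le]
  case time =>
    have := G.size_pos
    simp only [Expr.cost]
    calc 50 * G.size + (fs.length + 1) * (4 + 134 * (G.size * fs.length))
      _ ≤ 50 * (G.size * fs.length ^ 2) +
          (fs.length + fs.length) * (4 * (G.size * fs.length) + 134 * (G.size * fs.length)) := by
        gcongr <;> nlinarith [pow_pos hlen 2]
      _ = 326 * (G.size * fs.length ^ 2) := by ring

theorem Parsed.exists_outputs (h : Parsed W G fs fs.length s) :
    ∃ ids, IsEncoding fs ids ∧ s.Outputs ids := by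
  choose x hx hkind hvalue _ using fun j : Fin fs.length => h.records j j.2
  refine ⟨List.ofFn x, ⟨List.length_ofFn, fun i hi _ => ?_⟩,
    h.count.trans List.length_ofFn.symm, fun i hi => ?_⟩
  · simpa [hi] using hx ⟨i, hi⟩
  · rw [List.getElem_ofFn]
    exact ⟨hkind ⟨i, _⟩, hvalue ⟨i, _⟩⟩

end Parsing

end RAM

theorem theorem18_general :
    ∃ (P : RAM.Cmd) (C : ℕ), ∀ (σ W : ℕ) (G : SLP (Fin σ)),
      G.size < W → G.str.length < W →
        ∃ (fs : List (List (Fin σ))) (ids : List (LZ78.Id (Fin σ))),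
          LZ78.IsFactorization G.str fs ∧ LZ78.IsEncoding fs ids ∧
            ∃ (s : RAM.State) (t : ℕ),
              RAM.Exec W P G.initState s t ∧ s.Outputs ids ∧
                t ≤ C * (G.size * fs.length ^ 2) := by
  refine ⟨RAM.lz78, 326, fun σ W G hsize hlen => ?_⟩
  obtain ⟨fs, hfs⟩ := LZ78.exists_isFactorization G.str
  obtain ⟨s, t, hexec, ht, hs⟩ := RAM.runs_lz78 ⟨hsize, hlen⟩ hfs
  obtain ⟨ids, hids, hout⟩ := hs.exists_outputs
  exact ⟨fs, ids, hfs, hids, s, t, hexec, hout, ht⟩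

theorem theorem18 :
    ∃ (P : RAM.Cmd) (C : ℕ), ∀ (σ w : ℕ) (G : SLP (Fin σ)),
      σ ≤ 2 ^ w → G.size < 2 ^ w → G.str.length < 2 ^ w →
        ∃ (fs : List (List (Fin σ))) (ids : List (LZ78.Id (Fin σ))),
          LZ78.IsFactorization G.str fs ∧ LZ78.IsEncoding fs ids ∧
            ∃ (s : RAM.State) (t : ℕ),
              RAM.Exec (2 ^ w) P G.initState s t ∧ s.Outputs ids ∧
                t ≤ C * (G.size ^ 3 * fs.length ^ 2) := by
  obtain ⟨P, C, h⟩ := theorem18_general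
  refine ⟨P, C, fun σ w G _ hsize hlen => ?_⟩
  obtain ⟨fs, ids, hfs, hids, s, t, hexec, hout, ht⟩ := h σ (2 ^ w) G hsize hlen
  exact ⟨fs, ids, hfs, hids, s, t, hexec, hout,
    ht.trans (by gcongr; exact Nat.le_self_pow three_ne_zero _)⟩
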